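/- Finitely many squares are glued along sides: some sides are matched in pairs, and the two sides of each pair are identified by an affine homeomorphism that reverses the counterclockwise direction of the sides, as for neighboring squares in the plane. The boundary is the union of the unmatched sides. The result $\Delta$ is a \emph{quadriculated disk} if it is a closed topological disk in which every square is embedded and every vertex not on the boundary belongs to precisely four squares. Let $\Delta$ be a quadriculated disk whose squares are colored black and white so that squares with a common side have opposite colors, and suppose that the number $b$ of black squares equals the number $w$ of white squares. Label the black squares and the white squares by $1,\dots,b$, and let $B_\Delta$ be the $b\times b$ black-to-white matrix, with $(i,j)$ entry $1$ if the $i$-th black and the $j$-th white square share a side, and $0$ otherwise. Then $$\det(B_\Delta)\in\{0,1,-1\}.$$ Equivalently, the $(-1)$-weighted count of the domino tilings of $\Delta$ is $0$ or $\pm1$. Here a domino tiling $T$ is a bijection from the black squares to the white squares that pairs each black square with a white square sharing a side with it. If $\Delta$ has no domino tiling, the count is trivially $0$. Otherwise fix any tiling $T_0$; the count is $\sum_T \operatorname{sgn}(T_0^{-1}\circ T)$, where $T_0^{-1}\circ T$ is a permutation of the black squares (so exchanging the partners of two black squares changes the sign of the weight), and it equals $\det(B_\Delta)$ or $-\det(B_\Delta)$.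 -/

import Mathlib

/-- The model square `[0,1] × [0,1]`. -/
abbrev ModelSquare : Type := unitInterval × unitInterval

/-- The four sides of the model square, parametrized counterclockwise:
side `i` runs from the corner `i` to the corner `i + 1 (mod 4)`, where the corners
`0, 1, 2, 3` are `(0,0), (1,0), (1,1), (0,1)`. -/
def sidePoint : Fin 4 → unitInterval → ModelSquare
  | 0, t => (t, 0)
  | 1, t => (1, t)
  | 2, t => (unitInterval.symm t, 1)
  | 3, t => (0, unitInterval.symm t)

/-- Combinatorial data for juxtaposing a family of squares, indexed by `F`, along sides.
A side is a pair `(f, i)` of a square and an index `i`; the involution `glue` sends a side to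
the side to which it is attached, and its fixed points are the sides that are left free. -/
structure SquareGluing (F : Type*) where
  glue : F × Fin 4 → F × Fin 4
  glue_involutive : Function.Involutive glue

namespace SquareGluing

variable {F : Type*} (G : SquareGluing F)

/-- The elementary identifications on the disjoint union of the squares: a side is attached to
its mate by the affine map that reverses the counterclockwise parametrizations (so that the
orientations of the two squares agree). Free sides are not identified with anything. -/
def Attach (p q : (_ : F) × ModelSquare) : Prop :=
  ∃ (f : F) (i : Fin 4) (t : unitInterval), G.glue (f, i) ≠ (f, i) ∧
    p = ⟨f, sidePoint i t⟩ ∧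
    q = ⟨(G.glue (f, i)).1, sidePoint (G.glue (f, i)).2 (unitInterval.symm t)⟩

/-- The space formed by the squares: the quotient of the disjoint union of the squares by
the equivalence relation generated by the identifications of sides. -/
def Space : Type _ := Quot G.Attach

/-- The quotient topology. -/
instance : TopologicalSpace G.Space :=
  inferInstanceAs (TopologicalSpace (Quot G.Attach))

/-- The canonical map of the square `f` into the space. -/
def chart (f : F) (x : ModelSquare) : G.Space := Quot.mk _ ⟨f, x⟩

/-- The square `f` as a subset of the space. -/
def square (f : F) : Set G.Space := Set.range (G.chart f)

/-- The vertices: the images of the corners of the squares. -/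
def vertices : Set G.Space := {v | ∃ (f : F) (i : Fin 4), v = G.chart f (sidePoint i 0)}

/-- The boundary: the union of the free sides. -/
def boundary : Set G.Space :=
  {x | ∃ (f : F) (i : Fin 4) (t : unitInterval),
    G.glue (f, i) = (f, i) ∧ x = G.chart f (sidePoint i t)}

/-- A gluing of squares is a quadriculated disk if the resulting space is a closed topological
disk, in which every square is embedded, and every interior vertex belongs to precisely four
squares. -/
structure IsQuadriculatedDisk : Prop where
  homeomorph_disk :
    Nonempty (G.Space ≃ₜ Metric.closedBall (0 : EuclideanSpace ℝ (Fin 2)) 1)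
  square_embedded : ∀ f : F, Function.Injective (G.chart f)
  interior_vertex : ∀ v ∈ G.vertices, v ∉ G.boundary → {f : F | v ∈ G.square f}.ncard = 4

/-- The squares `f` and `g` share a side. -/
def ShareSide (f g : F) : Prop :=
  ∃ i j : Fin 4, G.glue (f, i) = (g, j) ∧ (f, i) ≠ (g, j)

/-- A bicoloring (`true` is black, `false` is white): squares with a common side have
opposite colors. -/
structure Bicoloring where
  color : F → Bool
  opposite : ∀ f g : F, G.ShareSide f g → color f ≠ color g

namespace Bicoloring

variable {G} (C : G.Bicoloring)

/-- The black squares. -/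
abbrev Black : Type _ := {f : F // C.color f = true}

/-- The white squares. -/
abbrev White : Type _ := {f : F // C.color f = false}

open Classical in
/-- The black-to-white matrix for a labeling of the black and of the white squares. -/
noncomputable def blackToWhite {b w : ℕ} (eb : C.Black ≃ Fin b) (ew : C.White ≃ Fin w) :
    Matrix (Fin b) (Fin w) ℤ :=
  Matrix.of fun i j =>
    if G.ShareSide ((eb.symm i : C.Black) : F) ((ew.symm j : C.White) : F) then 1 else 0

/-- A domino tiling: a pairing of all black squares with all white squares such that the two
squares of every pair (a domino) share a side. -/
def DominoTiling : Type _ :=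
  {T : C.Black ≃ C.White // ∀ x : C.Black, G.ShareSide (x : F) (T x : F)}

instance [Finite F] : Finite C.DominoTiling :=
  inferInstanceAs (Finite {T : C.Black ≃ C.White // ∀ x : C.Black, G.ShareSide (x : F) (T x : F)})

noncomputable instance [Finite F] : Fintype C.DominoTiling := Fintype.ofFinite _

open Classical in
/-- The weight `±1` of a tiling `T` relative to a reference tiling `T₀`: the sign of the
permutation of the black squares that sends `x` to the black square whose partner in `T₀` is the
partner of `x` in `T`. -/
noncomputable def tilingSign [Fintype F] (T₀ T : C.DominoTiling) : ℤˣ :=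
  Equiv.Perm.sign (T.1.trans T₀.1.symm)

/-- The weight is the one of the counting of tilings with `q = -1`: it is `1` at the reference
tiling and it changes sign under a flip, the exchange of the partners of two black squares. -/
theorem tilingSign_self [Fintype F] (T₀ : C.DominoTiling) : C.tilingSign T₀ T₀ = 1 := by
  simp [tilingSign]

theorem tilingSign_flip [Fintype F] (T₀ T T' : C.DominoTiling) (x y : C.Black) (hxy : x ≠ y)
    (hx : T'.1 x = T.1 y) (hy : T'.1 y = T.1 x)
    (h : ∀ z : C.Black, z ≠ x → z ≠ y → T'.1 z = T.1 z) :
    C.tilingSign T₀ T' = -C.tilingSign T₀ T := by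
  classical
  have key : T'.1.trans T₀.1.symm = (T.1.trans T₀.1.symm) * Equiv.swap x y := by
    ext1 z
    by_cases hzx : z = x
    · subst hzx; simp [hx]
    · by_cases hzy : z = y
      · subst hzy; simp [hy]
      · simp [h z hzx hzy, Equiv.swap_apply_of_ne_of_ne hzx hzy]
  unfold tilingSign
  convert congrArg Equiv.Perm.sign key using 1
  rw [Equiv.Perm.sign_mul, Equiv.Perm.sign_swap hxy]
  simp

/-- The `(-1)`-weighted count of the domino tilings, normalized by a reference tiling. -/
noncomputable def signedTilingCount [Fintype F] (T₀ : C.DominoTiling) : ℤ :=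
  ∑ T : C.DominoTiling, (C.tilingSign T₀ T : ℤ)

end Bicoloring

end SquareGluing

/-!
An integer square matrix has determinant `0` or `±1` as soon as every nontrivial kernel modulo a
prime forces a nontrivial kernel over `ℤ`. After a change of signs, the vectors in the kernel of the
black-to-white matrix are the functions on the white squares that satisfy, across each black square,
the discrete wave equation `g(left) + g(right) = g(below) + g(above)` with `g = 0` outside the disk;
the signs come from the parity of a coordinate of the developing map to the square lattice.

The differences of the values of such a function at consecutive sides of the black squares form a
flow along the diagonals of these squares, conserved at the vertices. Whatever the group of values,
the support of a nonzero flow carries a nonzero integral flow, because a set of edges with no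
closed circuit through a given one is separated by a cut. An integral flow on the diagonals is in
turn the flow of an integral solution: it integrates to a function on the sides since the disk is
simply connected, as one sees by lifting the identity to the covering that a closed cochain defines,
and this function is constant on the free sides of black squares since all free sides lie on a
single boundary circle.
-/

open Matrix Topology

section Permutations

variable {X : Type*}

/-- One step of the permutation `P` from a point outside `S`: the generator of the division of the
cycles of `P` into the segments that end at the points of `S`. -/
def StepOff (P : Equiv.Perm X) (S : Set X) (x y : X) : Prop := x ∉ S ∧ P x = y

namespace StepOff

variable {P : Equiv.Perm X} {S : Set X}

theorem rightUnique : Relator.RightUnique (StepOff P S) :=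
  fun _ _ _ h h' => h.2.symm.trans h'.2

theorem leftUnique : Relator.LeftUnique (StepOff P S) :=
  fun _ _ _ h h' => P.injective (h.2.trans h'.2.symm)

theorem reflTransGen_or_of_eqvGen {x y : X} (h : Relation.EqvGen (StepOff P S) x y) :
    Relation.ReflTransGen (StepOff P S) x y ∨ Relation.ReflTransGen (StepOff P S) y x := by
  induction h with
  | rel x y h => exact .inl (.single h)
  | refl x => exact .inl .refl
  | symm x y _ ih => exact ih.symm
  | trans x y z _ _ ih₁ ih₂ =>
    rcases ih₁ with hxy | hyx <;> rcases ih₂ with hyz | hzy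
    · exact .inl (hxy.trans hyz)
    · have hswap : Relator.RightUnique (Function.swap (StepOff P S)) :=
        fun _ _ _ h h' => leftUnique h h'
      exact (Relation.ReflTransGen.total_of_right_unique hswap (Relation.reflTransGen_swap.2 hxy)
        (Relation.reflTransGen_swap.2 hzy)).symm.imp Relation.reflTransGen_swap.1
          Relation.reflTransGen_swap.1
    · exact Relation.ReflTransGen.total_of_right_unique rightUnique hyx hyz
    · exact .inr (hzy.trans hyx)

theorem exists_iterate_eq_of_reflTransGen {x y : X}
    (h : Relation.ReflTransGen (StepOff P S) x y) :
    ∃ n, P^[n] x = y ∧ ∀ k < n, P^[k] x ∉ S := by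
  induction h with
  | refl => exact ⟨0, rfl, by simp⟩
  | tail _ hyz ih =>
    obtain ⟨n, rfl, hn⟩ := ih
    refine ⟨n + 1, (Function.iterate_succ_apply' ..).trans hyz.2, fun k hk => ?_⟩
    rcases Nat.lt_succ_iff_lt_or_eq.1 hk with hk | rfl
    exacts [hn k hk, hyz.1]

theorem sameCycle_of_eqvGen {x y : X} (h : Relation.EqvGen (StepOff P S) x y) :
    P.SameCycle x y := by
  induction h with
  | rel x y h => exact ⟨1, h.2⟩
  | refl x => exact .rfl
  | symm x y _ ih => exact ih.symm
  | trans x y z _ _ ih₁ ih₂ => exact ih₁.trans ih₂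

theorem reflTransGen_iff_of_notMem {x y : X} (hx : x ∉ S) (hy : y ∈ S) :
    Relation.ReflTransGen (StepOff P S) x y ↔ Relation.ReflTransGen (StepOff P S) (P x) y := by
  constructor
  · intro h
    obtain rfl | ⟨z, hz, hzy⟩ := h.cases_head
    · exact absurd hy hx
    · rwa [hz.2]
  · exact .head ⟨hx, rfl⟩

theorem eq_of_reflTransGen_of_mem {x y : X} (hx : x ∈ S)
    (h : Relation.ReflTransGen (StepOff P S) x y) : x = y := by
  obtain rfl | ⟨z, hz, -⟩ := h.cases_head
  exacts [rfl, absurd hx hz.1]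

theorem exists_extension [Finite X] {R : Type*} [AddCommMonoid R] (P : Equiv.Perm X) (S : Set X)
    (v : X → R) : ∃ χ : X → R, (∀ x ∈ S, χ x = v x) ∧ ∀ x ∉ S, χ (P x) = χ x := by
  classical
  have := Fintype.ofFinite X
  refine ⟨fun x => ∑ y with y ∈ S ∧ Relation.ReflTransGen (StepOff P S) x y, v y,
    fun x hx => ?_, fun x hx => ?_⟩
  · have hself :
        (Finset.univ.filter fun y => y ∈ S ∧ Relation.ReflTransGen (StepOff P S) x y) = {x} := by
      ext y
      simp only [Finset.mem_filter_univ, Finset.mem_singleton]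
      constructor
      · exact fun h => (eq_of_reflTransGen_of_mem hx h.2).symm
      · rintro rfl
        exact ⟨hx, .refl⟩
    simp only [hself, Finset.sum_singleton]
  · refine Finset.sum_congr (Finset.filter_congr fun y _ => ?_) fun _ _ => rfl
    exact and_congr_right fun hy => (reflTransGen_iff_of_notMem hx hy).symm

end StepOff

variable {P : Equiv.Perm X}

theorem eq_of_sameCycle_of_apply_eq [Finite X] {R : Type*} {χ : X → R}
    (h : ∀ x, χ (P x) = χ x) {x y : X} (hxy : P.SameCycle x y) : χ x = χ y := by
  obtain ⟨n, rfl⟩ := hxy.exists_nat_pow_eq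
  have hsemi : Function.Semiconj χ P id := h
  have hiter := hsemi.iterate_right n x
  rw [Function.iterate_id] at hiter
  exact hiter.symm

theorem sum_smul_sub_perm [Fintype X] {R M : Type*} [Ring R] [AddCommGroup M] [Module R M]
    (P : Equiv.Perm X) (χ : X → R) (H : X → M) :
    ∑ x, χ x • (H x - H (P x)) = ∑ x, (χ (P x) - χ x) • H (P x) := by
  have hP : ∑ x, χ (P x) • H (P x) = ∑ x, χ x • H x := Equiv.sum_comp P fun x => χ x • H x
  simp only [smul_sub, sub_smul, Finset.sum_sub_distrib, hP]

/-- Extend `H ∘ P` from `S` to a function `χ` that is constant along `P` off `S`: the squares of the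
increments of `χ` then sum to zero, so `χ` is constant on the cycles. -/
theorem apply_eq_of_sameCycle_of_sum_smul_sub_eq_zero [Fintype X] {R : Type*} [CommRing R]
    [LinearOrder R] [IsStrictOrderedRing R] {S : Set X} {H : X → R}
    (hH : ∀ χ : X → R, (∀ x ∉ S, χ (P x) = χ x) → ∑ x, χ x • (H x - H (P x)) = 0)
    {x y : X} (hx : x ∈ S) (hy : y ∈ S) (hxy : P.SameCycle x y) : H (P x) = H (P y) := by
  obtain ⟨χ, hχS, hχ⟩ := StepOff.exists_extension P S fun x => H (P x)
  have hsq : ∑ x, (χ (P x) - χ x) ^ 2 = 0 := calc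
    ∑ x, (χ (P x) - χ x) ^ 2
      = ∑ x, (χ (P x) ^ 2 - χ x ^ 2) - 2 * ∑ x, (χ (P x) - χ x) * χ x := by
      rw [Finset.mul_sum, ← Finset.sum_sub_distrib]
      exact Finset.sum_congr rfl fun x _ => by ring
    _ = 0 - 2 * ∑ x, (χ (P x) - χ x) • H (P x) := by
      rw [Finset.sum_sub_distrib, Equiv.sum_comp P fun x => χ x ^ 2, sub_self]
      congr 2
      refine Finset.sum_congr rfl fun x _ => ?_
      by_cases hx : x ∈ S
      · rw [hχS x hx, smul_eq_mul]
      · rw [hχ x hx, sub_self, zero_mul, zero_smul]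
    _ = 0 := by rw [← sum_smul_sub_perm, hH χ hχ, mul_zero, sub_zero]
  have hconst : ∀ x, χ (P x) = χ x := fun x =>
    sub_eq_zero.1 <| pow_eq_zero_iff two_ne_zero |>.1 <|
      (Finset.sum_eq_zero_iff_of_nonneg fun x _ => sq_nonneg _).1 hsq x (Finset.mem_univ x)
  rw [← hχS x hx, ← hχS y hy, eq_of_sameCycle_of_apply_eq hconst hxy]

theorem setOf_sameCycle [Finite X] (x : X) :
    {y | P.SameCycle x y} = (fun n => P^[n] x) '' Set.Iio (Function.minimalPeriod P x) := by
  ext y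
  constructor
  · intro h
    obtain ⟨n, rfl⟩ := h.exists_nat_pow_eq
    have hpos := Function.minimalPeriod_pos_of_mem_periodicPts (P.injective.mem_periodicPts x)
    exact ⟨n % Function.minimalPeriod P x, Nat.mod_lt _ hpos,
      Function.iterate_mod_minimalPeriod_eq⟩
  · rintro ⟨n, -, rfl⟩
    exact ⟨n, rfl⟩

theorem ncard_sameCycle [Finite X] (x : X) :
    {y | P.SameCycle x y}.ncard = Function.minimalPeriod P x := by
  rw [setOf_sameCycle, Function.iterate_injOn_Iio_minimalPeriod.ncard_image, ← Finset.coe_Iio,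
    Set.ncard_coe_finset, Nat.card_Iio]

theorem sum_sameCycle [Fintype X] {A : Type*} [AddCommMonoid A] (x : X)
    [DecidablePred (P.SameCycle x)] (f : X → A) :
    ∑ y with P.SameCycle x y, f y =
      ∑ k ∈ Finset.range (Function.minimalPeriod P x), f (P^[k] x) := by
  refine (Finset.sum_nbij (fun k => P^[k] x) (fun k _ => ?_) ?_ ?_ fun _ _ => rfl).symm
  · exact (Finset.mem_filter_univ _).2 ⟨k, rfl⟩
  · rw [Finset.coe_range]
    exact Function.iterate_injOn_Iio_minimalPeriod
  · rw [Finset.coe_range, Set.SurjOn, ← setOf_sameCycle, Finset.coe_filter_univ]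

end Permutations

section Flows

variable {X N : Type*} [Fintype X]

/-- A unit of flow from `a` to `b` on the graph with nodes `N` whose directed edges are the
elements of `X`: `d` starts at `ν d`, and `ι d` is its reversal. Only the edges in `D` are used.
The balance at the nodes is expressed by pairing with all functions `χ` on the nodes. -/
structure IsUnitFlow (ι : X → X) (ν : X → N) (D : Set X) (a b : N) (y : X → ℤ) : Prop where
  reverse : ∀ d, y (ι d) = -y d
  eq_zero : ∀ d ∉ D, y d = 0
  sum_mul : ∀ χ : N → ℤ, ∑ d, χ (ν d) * y d = χ a - χ b

variable {ι : X → X} {ν : X → N} {D : Set X}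

theorem IsUnitFlow.extend [DecidableEq X] (hι : Function.Involutive ι) (hD : ∀ d ∈ D, ι d ∈ D)
    {a : N} {d : X} (hd : d ∈ D) {y : X → ℤ} (hy : IsUnitFlow ι ν D a (ν d) y) :
    IsUnitFlow ι ν D a (ν (ι d)) (y + Pi.single d 1 - Pi.single (ι d) 1) where
  reverse e := by
    have he : e = ι d ↔ ι e = d := ⟨fun h => h ▸ hι d, fun h => h ▸ (hι e).symm⟩
    have he' : ι e = ι d ↔ e = d := hι.injective.eq_iff
    simp only [Pi.add_apply, Pi.sub_apply, Pi.single_apply, hy.reverse, he, he']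
    ring
  eq_zero e he := by
    have hed : e ≠ d := fun h => he (h ▸ hd)
    have hed' : e ≠ ι d := fun h => he (h ▸ hD d hd)
    simp [hy.eq_zero e he, hed, hed']
  sum_mul χ := by
    simp [mul_sub, mul_add, Finset.sum_sub_distrib, Finset.sum_add_distrib, hy.sum_mul,
      Pi.single_apply]

/-- The cut `χ` is the indicator function of the nodes that a unit of flow from `a` can reach. -/
theorem exists_isUnitFlow_or_cut (hι : Function.Involutive ι) (ν : X → N)
    (hD : ∀ d ∈ D, ι d ∈ D) (a b : N) :
    (∃ y, IsUnitFlow ι ν D a b y) ∨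
      ∃ χ : N → ℤ, (∀ d ∈ D, χ (ν (ι d)) = χ (ν d)) ∧ χ a = 1 ∧ χ b = 0 := by
  classical
  refine or_iff_not_imp_left.2 fun hb =>
    ⟨fun p => if ∃ y, IsUnitFlow ι ν D a p y then 1 else 0, fun d hd => ?_,
      if_pos ⟨0, ?_, ?_, ?_⟩, if_neg hb⟩
  · have hext : ∀ d ∈ D, (∃ y, IsUnitFlow ι ν D a (ν d) y) → ∃ y, IsUnitFlow ι ν D a (ν (ι d)) y :=
      fun d hd ⟨_, hy⟩ => ⟨_, hy.extend hι hD hd⟩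
    have hback := hext (ι d) (hD d hd)
    rw [hι d] at hback
    exact if_congr ⟨hback, hext d hd⟩ rfl rfl
  all_goals simp

/-- Either the edge `d₀` lies on a closed path in the support of `x`, or it is the only edge of a
cut of that support; in the second case the balance of `x` across the cut forces `x d₀ = 0`. -/
theorem exists_int_flow (hι : Function.Involutive ι) (hfix : ∀ d, ι d ≠ d) {A : Type*}
    [AddCommGroup A] {x : X → A} (hx : ∀ d, x (ι d) = -x d)
    (hbal : ∀ χ : N → ℤ, ∑ d, χ (ν d) • x d = 0) {d₀ : X} (hd₀ : x d₀ ≠ 0) :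
    ∃ y : X → ℤ, (∀ d, y (ι d) = -y d) ∧ (∀ χ : N → ℤ, ∑ d, χ (ν d) * y d = 0) ∧
      (∀ d, x d = 0 → y d = 0) ∧ y d₀ ≠ 0 := by
  classical
  let D : Set X := {d | x d ≠ 0 ∧ d ≠ d₀ ∧ d ≠ ι d₀}
  have hD : ∀ d ∈ D, ι d ∈ D := fun d hd =>
    ⟨by simpa [hx] using hd.1, fun h => hd.2.2 (by rw [← h, hι d]),
      fun h => hd.2.1 (hι.injective h)⟩
  obtain ⟨y, hy⟩ | ⟨χ, hχ, hχ₀, hχ₁⟩ :=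
    exists_isUnitFlow_or_cut hι ν hD (ν (ι d₀)) (ν d₀)
  · have hclosed : IsUnitFlow ι ν {d | x d ≠ 0} (ν (ι d₀)) (ν (ι d₀)) _ :=
      IsUnitFlow.extend (y := y) hι (by simp [hx]) (d := d₀) hd₀
        ⟨hy.reverse, fun d hd => hy.eq_zero d fun h => hd h.1, hy.sum_mul⟩
    refine ⟨_, hclosed.reverse, fun χ => (hclosed.sum_mul χ).trans (sub_self _),
      fun d hd => hclosed.eq_zero d (by simpa using hd), ?_⟩
    simp [hy.eq_zero d₀ fun h => h.2.1 rfl, (hfix d₀).symm]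
  · let z : X → A := fun d => χ (ν d) • x d - (Pi.single (ι d₀) (x (ι d₀)) : X → A) d
    have hpair : ∀ d, z d + z (ι d) = 0 := fun d => by
      unfold z
      by_cases h₀ : d = d₀
      · simp [h₀, hχ₀, hχ₁, (hfix d₀).symm]
      by_cases h₁ : d = ι d₀
      · simp [h₁, hι d₀, hχ₀, hχ₁, (hfix d₀).symm]
      have h₂ : ι d ≠ ι d₀ := hι.injective.ne h₀
      by_cases hxd : x d = 0
      · simp [hx, hxd, h₁, h₂]
      · simp [hx, hχ d ⟨hxd, h₀, h₁⟩, h₁, h₂]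
    have hsum := Finset.sum_involution (s := Finset.univ) (fun d _ => ι d) (fun d _ => hpair d)
      (fun d _ _ => hfix d) (fun _ _ => Finset.mem_univ _) (fun d _ => hι d)
    simp [z, Finset.sum_sub_distrib, hbal, hx, hd₀] at hsum

end Flows

section ModelSquare

/-- The open neighborhood of the corner `i` of the model square: the complement of the two sides
that do not contain this corner. -/
def cornerStar : Fin 4 → Set ModelSquare
  | 0 => {x | x.1 < 1 ∧ x.2 < 1}
  | 1 => {x | 0 < x.1 ∧ x.2 < 1}
  | 2 => {x | 0 < x.1 ∧ 0 < x.2}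
  | 3 => {x | x.1 < 1 ∧ 0 < x.2}

theorem isOpen_cornerStar (i : Fin 4) : IsOpen (cornerStar i) := by
  fin_cases i <;>
    exact (isOpen_lt (by fun_prop) (by fun_prop)).inter (isOpen_lt (by fun_prop) (by fun_prop))

theorem exists_mem_cornerStar (x : ModelSquare) : ∃ i, x ∈ cornerStar i := by
  rcases lt_or_ge x.1 1 with h | h <;> rcases lt_or_ge x.2 1 with h' | h'
  · exact ⟨0, h, h'⟩
  · exact ⟨3, h, zero_lt_one.trans_le h'⟩
  · exact ⟨1, zero_lt_one.trans_le h, h'⟩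
  · exact ⟨2, zero_lt_one.trans_le h, zero_lt_one.trans_le h'⟩

theorem unitInterval_symm_pos_iff {t : unitInterval} : 0 < unitInterval.symm t ↔ t < 1 := by
  rw [← unitInterval.symm_one, unitInterval.symm_lt_symm]

theorem unitInterval_symm_lt_one_iff {t : unitInterval} : unitInterval.symm t < 1 ↔ 0 < t := by
  rw [← unitInterval.symm_zero, unitInterval.symm_lt_symm]

theorem sidePoint_mem_cornerStar {i k : Fin 4} {t : unitInterval} :
    sidePoint i t ∈ cornerStar k ↔ (k = i ∧ t < 1) ∨ (k = i + 1 ∧ 0 < t) := by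
  fin_cases i <;> fin_cases k <;>
    simp [sidePoint, cornerStar, unitInterval_symm_pos_iff, unitInterval_symm_lt_one_iff]

theorem sidePoint_one (i : Fin 4) : sidePoint i 1 = sidePoint (i + 1) 0 := by
  fin_cases i <;> simp [sidePoint]

theorem sidePoint_eq_corner {i k : Fin 4} {t : unitInterval} :
    sidePoint i t = sidePoint k 0 ↔ (k = i ∧ t = 0) ∨ (k = i + 1 ∧ t = 1) := by
  fin_cases i <;> fin_cases k <;>
    simp [sidePoint, Prod.ext_iff, unitInterval.symm_eq_zero, unitInterval.symm_eq_one]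

theorem corner_injective : Function.Injective fun i : Fin 4 => sidePoint i 0 := by
  intro i k h
  rcases sidePoint_eq_corner.1 h with h | h
  · exact h.1.symm
  · exact absurd h.2 zero_ne_one

end ModelSquare

namespace SquareGluing

variable {F : Type*} (G : SquareGluing F)

section Corners

theorem continuous_chart (f : F) : Continuous (G.chart f) :=
  continuous_quot_mk.comp continuous_sigmaMk

variable {G} in
theorem exists_chart_eq (e : G.Space) : ∃ f x, e = G.chart f x := by
  induction e using Quot.ind with
  | mk p => exact ⟨p.1, p.2, rfl⟩

theorem chart_glue {f : F} {i : Fin 4} (h : G.glue (f, i) ≠ (f, i)) (t : unitInterval) :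
    G.chart f (sidePoint i t) =
      G.chart (G.glue (f, i)).1 (sidePoint (G.glue (f, i)).2 (unitInterval.symm t)) :=
  Quot.sound ⟨f, i, t, h, rfl, rfl⟩

variable {G} in
theorem Attach.symm {p q : (_ : F) × ModelSquare} (h : G.Attach p q) : G.Attach q p := by
  obtain ⟨f, i, t, hne, rfl, rfl⟩ := h
  refine ⟨(G.glue (f, i)).1, (G.glue (f, i)).2, unitInterval.symm t, ?_, rfl, ?_⟩
  · simpa [G.glue_involutive (f, i)] using hne.symm
  · simp [G.glue_involutive (f, i)]

variable {G} in
theorem of_chart_eq {p : F → ModelSquare → Prop}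
    (hp : ∀ f i t, G.glue (f, i) ≠ (f, i) → p f (sidePoint i t) →
      p (G.glue (f, i)).1 (sidePoint (G.glue (f, i)).2 (unitInterval.symm t)))
    {f g : F} {x y : ModelSquare} (h : G.chart f x = G.chart g y) (hx : p f x) : p g y := by
  have hmono : ∀ a b, G.Attach a b → p a.1 a.2 → p b.1 b.2 := by
    rintro _ _ ⟨f, i, t, hne, rfl, rfl⟩
    exact hp f i t hne
  let q : G.Space → Prop := Quot.lift (fun a => p a.1 a.2) fun a b hab =>
    propext ⟨hmono a b hab, hmono b a hab.symm⟩
  have hq : q (G.chart f x) = q (G.chart g y) := congrArg q h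
  exact hq.mp hx

/-- The permutation of the corners `(f, i)` that turns clockwise about a vertex: the corner `i` of
`f` is sent to the corner of the neighbor across the side `i - 1`. If this side is free, the result
is the corner `i - 1` of `f`, the next vertex along the boundary. -/
def rot : Equiv.Perm (F × Fin 4) :=
  ((Equiv.refl F).prodCongr (Equiv.subRight 1)).trans G.glue_involutive.toPerm

theorem rot_apply (κ : F × Fin 4) : G.rot κ = G.glue (κ.1, κ.2 - 1) := rfl

theorem glue_rot (κ : F × Fin 4) : G.glue (G.rot κ) = (κ.1, κ.2 - 1) := by
  rw [rot_apply, G.glue_involutive]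

theorem glue_eq_rot_succ (s : F × Fin 4) : G.glue s = G.rot (s.1, s.2 + 1) := by
  simp [rot_apply]

theorem rot_glue_succ (s : F × Fin 4) : G.rot ((G.glue s).1, (G.glue s).2 + 1) = s := by
  simp [rot_apply, G.glue_involutive s]

/-- The corner `(f, i)` is free if the side `i - 1` of `f`, which ends there, is free. -/
def FreeCorner (κ : F × Fin 4) : Prop := G.glue (κ.1, κ.2 - 1) = (κ.1, κ.2 - 1)

theorem glue_rot_eq_iff {κ : F × Fin 4} : G.glue (G.rot κ) = G.rot κ ↔ G.FreeCorner κ := by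
  rw [glue_rot, rot_apply, FreeCorner, eq_comm]

theorem freeCorner_succ_iff {s : F × Fin 4} :
    G.FreeCorner (s.1, s.2 + 1) ↔ G.glue s = s := by
  simp [FreeCorner]

theorem freeCorner_glue_succ_iff {s : F × Fin 4} :
    G.FreeCorner ((G.glue s).1, (G.glue s).2 + 1) ↔ G.glue s = s := by
  rw [freeCorner_succ_iff, G.glue_involutive s, eq_comm]

/-- The corner as a point of the space. -/
def cornerPoint (κ : F × Fin 4) : G.Space := G.chart κ.1 (sidePoint κ.2 0)

theorem cornerPoint_rot {κ : F × Fin 4} (h : ¬ G.FreeCorner κ) :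
    G.cornerPoint (G.rot κ) = G.cornerPoint κ := by
  have hglue := G.chart_glue h 1
  rw [sidePoint_one] at hglue
  simpa [cornerPoint, rot_apply] using hglue.symm

theorem cornerPoint_glue_succ {s : F × Fin 4} (h : G.glue s ≠ s) :
    G.cornerPoint ((G.glue s).1, (G.glue s).2 + 1) = G.cornerPoint s := by
  rw [← G.cornerPoint_rot (mt G.freeCorner_glue_succ_iff.1 h), rot_glue_succ]

theorem cornerPoint_glue {s : F × Fin 4} (h : G.glue s ≠ s) :
    G.cornerPoint (G.glue s) = G.cornerPoint (s.1, s.2 + 1) := by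
  rw [← G.cornerPoint_rot (mt G.freeCorner_succ_iff.1 h), ← glue_eq_rot_succ]

/-- The turns about a vertex that cross a glued side. -/
abbrev Turn : F × Fin 4 → F × Fin 4 → Prop := StepOff G.rot {κ | G.FreeCorner κ}

variable {G}

theorem turn_glue_succ {s : F × Fin 4} (h : G.glue s ≠ s) :
    G.Turn ((G.glue s).1, (G.glue s).2 + 1) s :=
  ⟨mt G.freeCorner_glue_succ_iff.1 h, G.rot_glue_succ s⟩

theorem turn_succ_glue {s : F × Fin 4} (h : G.glue s ≠ s) :
    G.Turn (s.1, s.2 + 1) (G.glue s) :=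
  ⟨mt G.freeCorner_succ_iff.1 h, (G.glue_eq_rot_succ s).symm⟩

theorem exists_eqvGen_of_chart_eq_cornerPoint {f : F} {x : ModelSquare} {κ : F × Fin 4}
    (h : G.chart f x = G.cornerPoint κ) :
    ∃ i, x = sidePoint i 0 ∧ Relation.EqvGen G.Turn κ (f, i) := by
  refine of_chart_eq (p := fun f x => ∃ i, x = sidePoint i 0 ∧ Relation.EqvGen G.Turn κ (f, i))
    ?_ h.symm ⟨κ.2, rfl, .refl _⟩
  rintro f i t hne ⟨k, hk, hlink⟩
  rcases sidePoint_eq_corner.1 hk with ⟨rfl, rfl⟩ | ⟨rfl, rfl⟩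
  · exact ⟨(G.glue (f, k)).2 + 1, by simp [sidePoint_one],
      hlink.trans _ _ _ (.symm _ _ (.rel _ _ (turn_glue_succ hne)))⟩
  · exact ⟨(G.glue (f, i)).2, by simp, hlink.trans _ _ _ (.rel _ _ (turn_succ_glue hne))⟩

theorem eqvGen_of_cornerPoint_eq {κ κ' : F × Fin 4} (h : G.cornerPoint κ' = G.cornerPoint κ) :
    Relation.EqvGen G.Turn κ κ' := by
  obtain ⟨i, hi, hlink⟩ := exists_eqvGen_of_chart_eq_cornerPoint h
  obtain rfl : κ'.2 = i := corner_injective hi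
  exact hlink

variable (G) in
/-- The corner `κ` lies at a vertex with no free side. -/
def InteriorCorner (κ : F × Fin 4) : Prop :=
  ∀ κ', G.rot.SameCycle κ κ' → ¬ G.FreeCorner κ'

theorem InteriorCorner.not_freeCorner_iterate {κ : F × Fin 4} (h : G.InteriorCorner κ) (k : ℕ) :
    ¬ G.FreeCorner (G.rot^[k] κ) := h _ ⟨k, rfl⟩

theorem InteriorCorner.cornerPoint_eq [Finite F] {κ κ' : F × Fin 4} (h : G.InteriorCorner κ)
    (hκ' : G.rot.SameCycle κ κ') : G.cornerPoint κ' = G.cornerPoint κ := by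
  obtain ⟨n, rfl⟩ := hκ'.exists_nat_pow_eq
  induction n with
  | zero => rfl
  | succ n ih =>
    have hn : G.rot.SameCycle κ ((G.rot ^ n) κ) := ⟨n, rfl⟩
    rw [pow_succ', Equiv.Perm.mul_apply, G.cornerPoint_rot (h _ hn), ih hn]

theorem InteriorCorner.cornerPoint_notMem_boundary {κ : F × Fin 4} (h : G.InteriorCorner κ) :
    G.cornerPoint κ ∉ G.boundary := by
  rintro ⟨f, i, t, hfree, hx⟩
  obtain ⟨k, hk, hlink⟩ := exists_eqvGen_of_chart_eq_cornerPoint hx.symm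
  refine h (f, i + 1) ?_ (G.freeCorner_succ_iff.2 hfree)
  rcases sidePoint_eq_corner.1 hk with ⟨rfl, -⟩ | ⟨rfl, -⟩
  · rw [← Equiv.Perm.sameCycle_apply_right, ← G.glue_eq_rot_succ (f, k), hfree]
    exact StepOff.sameCycle_of_eqvGen hlink
  · exact StepOff.sameCycle_of_eqvGen hlink

end Corners

namespace IsQuadriculatedDisk

variable {G} (hG : G.IsQuadriculatedDisk)

include hG

theorem corner_unique {f : F} {i j : Fin 4} (h : G.cornerPoint (f, i) = G.cornerPoint (f, j)) :
    i = j :=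
  corner_injective (hG.square_embedded f h)

theorem minimalPeriod_rot [Finite F] {κ : F × Fin 4} (h : G.InteriorCorner κ) :
    Function.minimalPeriod G.rot κ = 4 := by
  have hsquares : {f : F | G.cornerPoint κ ∈ G.square f} =
      Prod.fst '' {κ' | G.rot.SameCycle κ κ'} := by
    ext f
    constructor
    · rintro ⟨x, hx⟩
      obtain ⟨i, -, hlink⟩ := exists_eqvGen_of_chart_eq_cornerPoint hx
      exact ⟨(f, i), StepOff.sameCycle_of_eqvGen hlink, rfl⟩
    · rintro ⟨κ', hκ', rfl⟩
      exact ⟨_, h.cornerPoint_eq hκ'⟩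
  have hinj : Set.InjOn Prod.fst {κ' | G.rot.SameCycle κ κ'} := by
    rintro ⟨f, i⟩ hi ⟨_, j⟩ hj rfl
    rw [hG.corner_unique ((h.cornerPoint_eq hi).trans (h.cornerPoint_eq hj).symm)]
  rw [← ncard_sameCycle, ← hinj.ncard_image, ← hsquares]
  exact hG.interior_vertex _ ⟨κ.1, κ.2, rfl⟩ h.cornerPoint_notMem_boundary

end IsQuadriculatedDisk

end SquareGluing

namespace SquareGluing

variable {F : Type*} (G : SquareGluing F)

section OpenStar

/-- The open star of the vertex `v`: the union of the open neighborhoods of the corners at `v`. -/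
def openStar (v : G.Space) : Set G.Space :=
  {e | ∃ f i, ∃ x ∈ cornerStar i, G.cornerPoint (f, i) = v ∧ G.chart f x = e}

variable {G}

theorem chart_mem_openStar_iff {v : G.Space} {f : F} {x : ModelSquare} :
    G.chart f x ∈ G.openStar v ↔ ∃ i, x ∈ cornerStar i ∧ G.cornerPoint (f, i) = v := by
  refine ⟨?_, fun ⟨i, hx, hv⟩ => ⟨f, i, x, hx, hv, rfl⟩⟩
  rintro ⟨g, j, y, hy, hv, h⟩
  refine of_chart_eq (p := fun f x => ∃ i, x ∈ cornerStar i ∧ G.cornerPoint (f, i) = v)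
    ?_ h ⟨j, hy, hv⟩
  rintro f i t hne ⟨k, hx, hk⟩
  rcases sidePoint_mem_cornerStar.1 hx with ⟨rfl, ht⟩ | ⟨rfl, ht⟩
  · exact ⟨(G.glue (f, k)).2 + 1,
      sidePoint_mem_cornerStar.2 (.inr ⟨rfl, unitInterval_symm_pos_iff.2 ht⟩),
      (G.cornerPoint_glue_succ hne).trans hk⟩
  · exact ⟨(G.glue (f, i)).2,
      sidePoint_mem_cornerStar.2 (.inl ⟨rfl, unitInterval_symm_lt_one_iff.2 ht⟩),
      (G.cornerPoint_glue hne).trans hk⟩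

theorem isOpen_openStar (v : G.Space) : IsOpen (G.openStar v) := by
  refine (isQuotientMap_quot_mk (r := G.Attach)).isOpen_preimage.1 (isOpen_sigma_iff.2 fun f => ?_)
  have hpre : G.chart f ⁻¹' G.openStar v = ⋃ i ∈ {i | G.cornerPoint (f, i) = v}, cornerStar i := by
    ext x
    simp [chart_mem_openStar_iff, and_comm]
  change IsOpen (G.chart f ⁻¹' G.openStar v)
  rw [hpre]
  exact isOpen_biUnion fun i _ => isOpen_cornerStar i

theorem exists_openStar_mem_nhds (e : G.Space) : ∃ v, G.openStar v ∈ 𝓝 e := by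
  obtain ⟨f, x, rfl⟩ := exists_chart_eq e
  obtain ⟨i, hi⟩ := exists_mem_cornerStar x
  exact ⟨_, (isOpen_openStar _).mem_nhds (chart_mem_openStar_iff.2 ⟨i, hi, rfl⟩)⟩

end OpenStar

instance : LocallyPathConnectedSpace G.Space :=
  have : LocallyPathConnectedSpace unitInterval := (convex_Icc 0 1).locallyPathConnectedSpace
  inferInstanceAs (LocallyPathConnectedSpace (Quot G.Attach))

section Cover

variable {A : Type*} [AddCommGroup A]

/-- A cochain on the sides with values in `A`, antisymmetric under the gluing and zero on the free
sides. -/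
structure SideCochain (A : Type*) [AddCommGroup A] where
  val : F × Fin 4 → A
  val_glue : ∀ s, val (G.glue s) = -val s
  val_free : ∀ s, G.glue s = s → val s = 0

variable {G}

namespace SideCochain

variable (c : G.SideCochain A)

/-- The sum of the cochain over the sides crossed by a turn about any vertex with no free side
is zero. -/
def IsClosed : Prop :=
  ∀ κ, G.InteriorCorner κ →
    ∑ k ∈ Finset.range (Function.minimalPeriod G.rot κ), c.val (G.rot^[k + 1] κ) = 0

/-- The gluing with one copy of each square for every element of `A`, where crossing a side `s`
shifts the copy by `c.val s`. -/
def cover : SquareGluing (F × A) where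
  glue s := (((G.glue (s.1.1, s.2)).1, s.1.2 + c.val (s.1.1, s.2)), (G.glue (s.1.1, s.2)).2)
  glue_involutive := by
    rintro ⟨⟨f, α⟩, i⟩
    simp [G.glue_involutive (f, i), c.val_glue]

theorem cover_glue (f : F) (α : A) (i : Fin 4) :
    c.cover.glue ((f, α), i) =
      (((G.glue (f, i)).1, α + c.val (f, i)), (G.glue (f, i)).2) := rfl

theorem cover_glue_eq_iff {f : F} {α : A} {i : Fin 4} :
    c.cover.glue ((f, α), i) = ((f, α), i) ↔ G.glue (f, i) = (f, i) := by
  rw [c.cover_glue]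
  constructor
  · intro h
    simp only [Prod.mk.injEq] at h
    exact Prod.ext h.1.1 h.2
  · intro h
    simp [h, c.val_free _ h]

theorem cover_rot (f : F) (α : A) (i : Fin 4) :
    c.cover.rot ((f, α), i) =
      (((G.rot (f, i)).1, α - c.val (G.rot (f, i))), (G.rot (f, i)).2) := by
  rw [rot_apply, G.rot_apply, c.val_glue, sub_neg_eq_add]
  rfl

theorem cover_rot_iterate (n : ℕ) (f : F) (α : A) (i : Fin 4) :
    c.cover.rot^[n] ((f, α), i) =
      (((G.rot^[n] (f, i)).1, α - ∑ k ∈ Finset.range n, c.val (G.rot^[k + 1] (f, i))),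
        (G.rot^[n] (f, i)).2) := by
  induction n with
  | zero => simp
  | succ n ih =>
    rw [Function.iterate_succ_apply', ih, c.cover_rot, Finset.sum_range_succ, sub_add_eq_sub_sub,
      Function.iterate_succ_apply' G.rot]

theorem IsClosed.isPeriodicPt_cover_rot {c : G.SideCochain A} (hc : c.IsClosed) {f : F}
    {i : Fin 4} (h : G.InteriorCorner (f, i)) (α : A) :
    Function.IsPeriodicPt c.cover.rot (Function.minimalPeriod G.rot (f, i)) ((f, α), i) := by
  rw [Function.IsPeriodicPt, Function.IsFixedPt, c.cover_rot_iterate, hc _ h,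
    Function.iterate_minimalPeriod, sub_zero]

/-- A path of corners around a vertex from one copy of a corner to another is either trivial or
closes up in the base, where the turn crosses no free side. -/
theorem IsClosed.eq_of_reflTransGen [Finite F] {c : G.SideCochain A} (hc : c.IsClosed) {f : F}
    {i : Fin 4} {α β : A}
    (h : Relation.ReflTransGen c.cover.Turn ((f, α), i) ((f, β), i)) : α = β := by
  obtain ⟨n, hn, hfree⟩ := StepOff.exists_iterate_eq_of_reflTransGen h
  rcases n.eq_zero_or_pos with rfl | hpos
  · simpa using hn
  have hper : Function.IsPeriodicPt G.rot n (f, i) := by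
    simp only [c.cover_rot_iterate, Prod.mk.injEq] at hn
    exact Prod.ext hn.1.1 hn.2
  have hint : G.InteriorCorner (f, i) := by
    intro κ hκ hκfree
    obtain ⟨m, rfl⟩ := hκ.exists_nat_pow_eq
    refine hfree (m % n) (Nat.mod_lt m hpos) ?_
    rw [Equiv.Perm.coe_pow, ← hper.iterate_mod_apply m] at hκfree
    rw [c.cover_rot_iterate]
    exact c.cover_glue_eq_iff.2 hκfree
  have hfix := (hc.isPeriodicPt_cover_rot hint α).trans_dvd hper.minimalPeriod_dvd
  simpa using hfix.symm.trans hn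

theorem IsClosed.eq_of_cornerPoint_eq [Finite F] {c : G.SideCochain A} (hc : c.IsClosed) {f : F}
    {i : Fin 4} {α β : A}
    (h : c.cover.cornerPoint ((f, α), i) = c.cover.cornerPoint ((f, β), i)) : α = β := by
  rcases StepOff.reflTransGen_or_of_eqvGen (eqvGen_of_cornerPoint_eq h) with h | h
  exacts [(hc.eq_of_reflTransGen h).symm, hc.eq_of_reflTransGen h]

/-- The projection of the cover to the original space. -/
def proj : c.cover.Space → G.Space :=
  Quot.lift (fun p => G.chart p.1.1 p.2) (by
    rintro _ _ ⟨⟨f, α⟩, i, t, h, rfl, rfl⟩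
    exact G.chart_glue (mt c.cover_glue_eq_iff.2 h) t)

theorem proj_chart (f : F) (α : A) (x : ModelSquare) :
    c.proj (c.cover.chart (f, α) x) = G.chart f x := rfl

theorem exists_chart_eq (e : c.cover.Space) : ∃ f α x, e = c.cover.chart (f, α) x := by
  obtain ⟨⟨f, α⟩, x, h⟩ := SquareGluing.exists_chart_eq e
  exact ⟨f, α, x, h⟩

/-- The translation of the copies by an element of `A`. -/
def translate (α : A) : c.cover.Space → c.cover.Space :=
  Quot.lift (fun p => c.cover.chart (p.1.1, α + p.1.2) p.2) (by
    rintro _ _ ⟨⟨f, β⟩, i, t, h, rfl, rfl⟩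
    have h' : c.cover.glue ((f, α + β), i) ≠ ((f, α + β), i) :=
      mt c.cover_glue_eq_iff.1 (mt c.cover_glue_eq_iff.2 h)
    simpa [c.cover_glue, add_assoc] using c.cover.chart_glue h' t)

instance : AddAction A c.cover.Space where
  vadd := c.translate
  zero_vadd e := by
    obtain ⟨f, α, x, rfl⟩ := c.exists_chart_eq e
    exact congrArg (fun β => c.cover.chart (f, β) x) (zero_add α)
  add_vadd α β e := by
    obtain ⟨f, γ, x, rfl⟩ := c.exists_chart_eq e
    exact congrArg (fun β => c.cover.chart (f, β) x) (add_assoc α β γ)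

theorem vadd_chart (α : A) (f : F) (β : A) (x : ModelSquare) :
    α +ᵥ c.cover.chart (f, β) x = c.cover.chart (f, α + β) x := rfl

theorem isQuotientMap_proj : IsQuotientMap c.proj := by
  have hproj : Continuous c.proj :=
    continuous_quot_lift _ (continuous_sigma fun p => G.continuous_chart p.1)
  have hsection : Continuous fun p : (_ : F) × ModelSquare => c.cover.chart (p.1, 0) p.2 :=
    continuous_sigma fun f => c.cover.continuous_chart (f, 0)
  exact .of_comp hsection hproj isQuotientMap_quot_mk

theorem proj_eq_iff {e₁ e₂ : c.cover.Space} :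
    c.proj e₁ = c.proj e₂ ↔ e₁ ∈ AddAction.orbit A e₂ := by
  obtain ⟨f, α, x, rfl⟩ := c.exists_chart_eq e₁
  obtain ⟨g, β, y, rfl⟩ := c.exists_chart_eq e₂
  constructor
  · intro h
    obtain ⟨γ, hγ⟩ : ∃ γ, c.cover.chart (g, γ) y = c.cover.chart (f, α) x := by
      refine of_chart_eq (p := fun g y => ∃ γ, c.cover.chart (g, γ) y = c.cover.chart (f, α) x)
        ?_ h ⟨α, rfl⟩
      rintro g i t hne ⟨γ, hγ⟩
      exact ⟨γ + c.val (g, i),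
        (c.cover.chart_glue (mt c.cover_glue_eq_iff.1 hne) t).symm.trans hγ⟩
    exact ⟨γ - β, (c.vadd_chart ..).trans (by rw [sub_add_cancel, hγ])⟩
  · rintro ⟨γ, hγ⟩
    rw [← hγ]
    rfl

theorem IsClosed.isAddQuotientCoveringMap [Finite F] {c : G.SideCochain A} (hc : c.IsClosed)
    (hG : ∀ f : F, Function.Injective (G.chart f)) : IsAddQuotientCoveringMap c.proj A where
  toIsQuotientMap := c.isQuotientMap_proj
  continuous_const_vadd α :=
    continuous_quot_lift _ (continuous_sigma fun p => c.cover.continuous_chart (p.1, α + p.2))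
  apply_eq_iff_mem_orbit := c.proj_eq_iff
  disjoint e := by
    obtain ⟨v, hv⟩ := exists_openStar_mem_nhds e
    refine ⟨_, hv, ?_⟩
    rintro δ ⟨_, ⟨e', he', rfl⟩, he⟩
    obtain ⟨f, α, x, rfl⟩ := c.exists_chart_eq e'
    obtain ⟨i, -, hi⟩ := chart_mem_openStar_iff.1 he'
    obtain ⟨j, -, hj⟩ := chart_mem_openStar_iff.1 he
    have hij : c.cover.cornerPoint ((f, α), i) = c.cover.cornerPoint ((f, δ + α), j) :=
      hi.trans hj.symm
    obtain rfl : i = j := corner_injective (hG f (congrArg c.proj hij))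
    exact add_eq_right.1 (hc.eq_of_cornerPoint_eq hij).symm

/-- The lift of the identity to the covering defined by `c` labels every square by an element
of `A`. -/
theorem IsClosed.exists_potential [Finite F] [SimplyConnectedSpace G.Space] {c : G.SideCochain A}
    (hc : c.IsClosed) (hG : ∀ f : F, Function.Injective (G.chart f)) :
    ∃ n : F → A, ∀ s, n (G.glue s).1 = n s.1 + c.val s := by
  have hq := hc.isAddQuotientCoveringMap hG
  obtain ⟨o⟩ : Nonempty G.Space := inferInstance
  obtain ⟨e₀, he₀⟩ := hq.surjective o
  obtain ⟨lift, ⟨-, hlift⟩, -⟩ :=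
    hq.isCoveringMap.existsUnique_continuousMap_lifts (.id G.Space) o e₀ he₀
  have hproj : ∀ e, c.proj (lift e) = e := congrFun hlift
  have hlabel : ∀ f, ∃ α : A, ∀ x, lift (G.chart f x) = c.cover.chart (f, α) x := by
    intro f
    obtain ⟨α, hα⟩ := hq.apply_eq_iff_mem_orbit.1
      ((hproj (G.chart f 0)).trans (c.proj_chart f 0 0).symm)
    simp only [c.vadd_chart, add_zero] at hα
    refine ⟨α, congrFun (hq.isCoveringMap.eq_of_comp_eq
      (lift.continuous.comp (G.continuous_chart f)) (c.cover.continuous_chart (f, α)) ?_ 0 hα.symm)⟩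
    exact funext fun x => hproj _
  choose n hn using hlabel
  refine ⟨n, fun ⟨f, i⟩ => ?_⟩
  by_cases hfree : G.glue (f, i) = (f, i)
  · rw [hfree, c.val_free _ hfree, add_zero]
  have hglue := calc
    c.cover.cornerPoint (((G.glue (f, i)).1, n (G.glue (f, i)).1), (G.glue (f, i)).2)
      = lift (G.cornerPoint (G.glue (f, i))) := (hn _ _).symm
    _ = lift (G.cornerPoint (f, i + 1)) := by rw [G.cornerPoint_glue hfree]
    _ = c.cover.cornerPoint ((f, n f), i + 1) := hn _ _
    _ = c.cover.cornerPoint (c.cover.glue ((f, n f), i)) :=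
      (c.cover.cornerPoint_glue (mt c.cover_glue_eq_iff.1 hfree)).symm
  exact hc.eq_of_cornerPoint_eq hglue

end SideCochain

end Cover

namespace IsQuadriculatedDisk

variable {G} (hG : G.IsQuadriculatedDisk)

include hG

theorem simplyConnectedSpace : SimplyConnectedSpace G.Space := by
  obtain ⟨Φ⟩ := hG.homeomorph_disk
  have hball : Convex ℝ (Metric.closedBall (0 : EuclideanSpace ℝ (Fin 2)) 1) :=
    convex_closedBall _ _
  have := hball.contractibleSpace ⟨0, by simp⟩
  have := Φ.contractibleSpace
  infer_instance

end IsQuadriculatedDisk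
end SquareGluing

namespace SquareGluing

variable {F : Type*} {G : SquareGluing F}

section RotInvariant

theorem sum_smul_glue [Fintype F] {A : Type*} [AddCommGroup A] {w : F × Fin 4 → ℤ}
    (hw : ∀ κ, w (G.rot κ) = w κ) (x : F × Fin 4 → A) :
    ∑ s, w s • x (G.glue s) = ∑ s, w s • x (s.1, s.2 - 1) := by
  simp only [← Equiv.sum_comp G.rot fun s => w s • x (G.glue s), hw, glue_rot]

theorem SideCochain.isClosed_of_sum_smul_eq_zero [Fintype F] {A : Type*} [AddCommGroup A]
    {c : G.SideCochain A}
    (hc : ∀ w : F × Fin 4 → ℤ, (∀ κ, w (G.rot κ) = w κ) → (∀ κ, G.FreeCorner κ → w κ = 0) →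
      ∑ s, w s • c.val s = 0) : c.IsClosed := by
  classical
  intro κ hκ
  let w : F × Fin 4 → ℤ := fun κ' => if G.rot.SameCycle κ κ' then 1 else 0
  have hw : ∀ κ', w (G.rot κ') = w κ' := fun κ' =>
    if_congr Equiv.Perm.sameCycle_apply_right rfl rfl
  have hfree : ∀ κ', G.FreeCorner κ' → w κ' = 0 := fun κ' h => if_neg fun h' => hκ κ' h' h
  calc
    ∑ k ∈ Finset.range (Function.minimalPeriod G.rot κ), c.val (G.rot^[k + 1] κ)
      = ∑ κ' with G.rot.SameCycle κ κ', c.val (G.rot κ') := by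
        simp only [sum_sameCycle, Function.iterate_succ_apply']
    _ = ∑ κ', w (G.rot κ') • c.val (G.rot κ') := by
        simp only [hw, w, ite_smul, one_smul, zero_smul, Finset.sum_filter]
    _ = 0 := (Equiv.sum_comp G.rot fun s => w s • c.val s).trans (hc w hw hfree)

theorem eq_of_glue [PreconnectedSpace G.Space] {R : Type*} {u : F → R}
    (hu : ∀ s, u (G.glue s).1 = u s.1) (f g : F) : u f = u g := by
  let _ : TopologicalSpace R := ⊥
  have : DiscreteTopology R := ⟨rfl⟩
  let label : G.Space → R := Quot.lift (fun p => u p.1) (by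
    rintro _ _ ⟨f, i, t, -, rfl, rfl⟩
    exact (hu (f, i)).symm)
  have hlabel : Continuous label :=
    continuous_quot_lift _ (continuous_sigma fun f => continuous_const (y := u f))
  exact PreconnectedSpace.constant inferInstance hlabel (x := G.chart f 0) (y := G.chart g 0)

theorem eq_of_rot_of_succ [PreconnectedSpace G.Space] {R : Type*} {w : F × Fin 4 → R}
    (hrot : ∀ κ, w (G.rot κ) = w κ) (hsucc : ∀ s : F × Fin 4, w (s.1, s.2 + 1) = w s)
    (κ κ' : F × Fin 4) : w κ = w κ' := by
  have hsquare : ∀ s : F × Fin 4, w s = w (s.1, 0) := by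
    rintro ⟨f, i⟩
    fin_cases i
    · rfl
    · exact hsucc (f, 0)
    · exact (hsucc (f, 1)).trans (hsucc (f, 0))
    · exact (hsucc (f, 2)).trans ((hsucc (f, 1)).trans (hsucc (f, 0)))
  rw [hsquare κ, hsquare κ']
  refine eq_of_glue (G := G) (u := fun f => w (f, 0)) (fun s => ?_) κ.1 κ'.1
  rw [← hsquare, ← hsquare, glue_eq_rot_succ, hrot, hsucc]

end RotInvariant

/-- The unit vectors of the plane, in counterclockwise order. -/
def unitStep : Fin 4 → ℤ × ℤ
  | 0 => (0, -1)
  | 1 => (1, 0)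
  | 2 => (0, 1)
  | 3 => (-1, 0)

namespace IsQuadriculatedDisk

variable {A : Type*} [AddCommGroup A] (hG : G.IsQuadriculatedDisk)

include hG

theorem exists_potential [Finite F] {c : G.SideCochain A} (hc : c.IsClosed) :
    ∃ n : F → A, ∀ s, n (G.glue s).1 = n s.1 + c.val s :=
  have := hG.simplyConnectedSpace
  hc.exists_potential hG.square_embedded

theorem exists_potential_of_sum_turn_eq_zero [Finite F] {c : F × Fin 4 → A}
    (hneg : ∀ s, G.glue s ≠ s → c (G.glue s) = -c s)
    (hturn : ∀ κ, G.InteriorCorner κ → ∑ k ∈ Finset.range 4, c (G.rot^[k + 1] κ) = 0) :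
    ∃ n : F → A, ∀ s, G.glue s ≠ s → n (G.glue s).1 = n s.1 + c s := by
  classical
  let c₀ : G.SideCochain A :=
    { val := fun s => if G.glue s = s then 0 else c s
      val_glue := fun s => by
        by_cases hs : G.glue s = s
        · simp [hs]
        · simp [hs, Ne.symm hs, G.glue_involutive s, hneg s hs]
      val_free := fun s hs => if_pos hs }
  have hc₀ : ∀ s, G.glue s ≠ s → c₀.val s = c s := fun s hs => if_neg hs
  have hclosed : c₀.IsClosed := by
    intro κ hκ
    rw [hG.minimalPeriod_rot hκ, ← hturn κ hκ]
    refine Finset.sum_congr rfl fun k _ => hc₀ _ ?_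
    rw [Function.iterate_succ_apply']
    exact mt G.glue_rot_eq_iff.1 (hκ.not_freeCorner_iterate k)
  obtain ⟨n, hn⟩ := hG.exists_potential hclosed
  exact ⟨n, fun s hs => by rw [hn, hc₀ s hs]⟩

theorem exists_direction [Finite F] :
    ∃ r : F → Fin 4, ∀ s, G.glue s ≠ s → (G.glue s).2 + r (G.glue s).1 = s.2 + r s.1 + 2 := by
  let c : F × Fin 4 → Fin 4 := fun s => s.2 - (G.glue s).2 + 2
  have hneg : ∀ s, c (G.glue s) = -c s := fun s => by
    have hmod : ∀ i j : Fin 4, j - i + 2 = -(i - j + 2) := by decide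
    simp only [c, G.glue_involutive s, hmod s.2]
  have hrot : ∀ κ, c (G.rot κ) = (G.rot κ).2 - κ.2 + 3 := fun κ => by
    have hmod : ∀ i j : Fin 4, i - (j - 1) + 2 = i - j + 3 := by decide
    simp only [c, glue_rot, hmod]
  have hturn : ∀ κ, G.InteriorCorner κ → ∑ k ∈ Finset.range 4, c (G.rot^[k + 1] κ) = 0 := by
    intro κ hκ
    have hperiod := Function.iterate_minimalPeriod (f := G.rot) (x := κ)
    rw [hG.minimalPeriod_rot hκ] at hperiod
    calc
      ∑ k ∈ Finset.range 4, c (G.rot^[k + 1] κ)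
        = ∑ k ∈ Finset.range 4, ((G.rot^[k + 1] κ).2 - (G.rot^[k] κ).2 + 3) := by
          simp only [Function.iterate_succ_apply', hrot]
      _ = (G.rot^[4] κ).2 - κ.2 + 4 • 3 := by
          rw [Finset.sum_add_distrib, Finset.sum_range_sub fun k => (G.rot^[k] κ).2]
          rfl
      _ = 0 := by rw [hperiod, sub_self]; rfl
  obtain ⟨r, hr⟩ := hG.exists_potential_of_sum_turn_eq_zero (fun s _ => hneg s) hturn
  refine ⟨r, fun s hs => ?_⟩
  have hmod : ∀ i j k : Fin 4, j + (k + (i - j + 2)) = i + k + 2 := by decide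
  rw [hr s hs, hmod]

/-- The developing map to the square lattice of the plane: crossing a side is a unit step whose
direction turns with the side. -/
theorem exists_position [Finite F] :
    ∃ (r : F → Fin 4) (pos : F → ℤ × ℤ), ∀ s, G.glue s ≠ s →
      pos (G.glue s).1 = pos s.1 + unitStep (s.2 + r s.1) := by
  obtain ⟨r, hr⟩ := hG.exists_direction
  have hneg : ∀ d, unitStep (d + 2) = -unitStep d := by decide
  have hsum : ∀ d, ∑ k ∈ Finset.range 4, unitStep (d + (k + 1) • 1) = 0 := by decide
  refine ⟨r, hG.exists_potential_of_sum_turn_eq_zero (fun s hs => by rw [hr s hs, hneg])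
    fun κ hκ => ?_⟩
  have hturn : ∀ k : ℕ,
      (G.rot^[k] κ).2 + r (G.rot^[k] κ).1 = κ.2 + r κ.1 + k • 1 := by
    intro k
    induction k with
    | zero => simp
    | succ k ih =>
      have hmod : ∀ i j : Fin 4, i - 1 + j + 2 = i + j + 1 := by decide
      rw [Function.iterate_succ_apply', rot_apply, hr _ (hκ.not_freeCorner_iterate k), hmod, ih,
        succ_nsmul, add_assoc]
  simp only [hturn, hsum]

theorem side_unique [Finite F] {f : F} {i j : Fin 4} (hi : G.glue (f, i) ≠ (f, i))
    (hj : G.glue (f, j) ≠ (f, j)) (h : (G.glue (f, i)).1 = (G.glue (f, j)).1) : i = j := by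
  obtain ⟨r, pos, hpos⟩ := hG.exists_position
  have hstep : unitStep (i + r f) = unitStep (j + r f) := by
    rw [← add_right_inj (pos f), ← hpos _ hi, ← hpos _ hj, h]
  have hinj : Function.Injective unitStep := by decide
  exact add_right_cancel (hinj hstep)

/-- The signs are given by the parity of the first coordinate of the position. -/
theorem exists_sign [Finite F] :
    ∃ σ τ : F → ℤˣ, ∀ s, G.glue s ≠ s → σ (G.glue s).1 = τ s.1 * (-1) ^ (s.2 : ℕ) := by
  obtain ⟨r, pos, hpos⟩ := hG.exists_position
  refine ⟨fun f => (pos f).1.negOnePow, fun f => (pos f).1.negOnePow * (-1) ^ (r f : ℕ),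
    fun s hs => ?_⟩
  have hsign : ∀ i k : Fin 4, (unitStep (i + k)).1.negOnePow =
      (-1) ^ (k : ℕ) * (-1) ^ (i : ℕ) := by decide
  simp only [hpos s hs, Prod.fst_add, Int.negOnePow_add, hsign, mul_assoc]

/-- All free sides lie on one boundary circle. Otherwise a unit of flow from one circle to another,
as a closed cochain, has a potential, so that the net flow into either circle is zero. -/
theorem sameCycle_rot [Finite F] {κ₁ κ₂ : F × Fin 4} (h₁ : G.FreeCorner κ₁)
    (h₂ : G.FreeCorner κ₂) : G.rot.SameCycle κ₁ κ₂ := by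
  have := Fintype.ofFinite F
  have := hG.simplyConnectedSpace
  by_contra hne
  let ν : F × Fin 4 → Quotient (Equiv.Perm.SameCycle.setoid G.rot) := Quotient.mk _
  have hν : ∀ κ, ν (G.rot κ) = ν κ := fun κ =>
    Quotient.sound (Equiv.Perm.sameCycle_apply_left.2 .rfl)
  rcases exists_isUnitFlow_or_cut (D := Set.univ) G.glue_involutive ν (fun _ _ => trivial)
    (ν κ₁) (ν κ₂) with ⟨y, hy⟩ | ⟨χ, hχ, hχ₁, hχ₂⟩
  · let c : G.SideCochain ℤ :=
      { val := y
        val_glue := hy.reverse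
        val_free := fun s hs => self_eq_neg.1 ((congrArg y hs).symm.trans (hy.reverse s)) }
    have hsum : ∀ w : F × Fin 4 → ℤ, (∀ κ, w (G.rot κ) = w κ) →
        ∑ s, w s • c.val s = w κ₁ - w κ₂ := fun w hw =>
      hy.sum_mul (Quotient.lift w fun _ _ h => eq_of_sameCycle_of_apply_eq hw h)
    obtain ⟨n, hn⟩ := hG.exists_potential (c := c) <|
      SideCochain.isClosed_of_sum_smul_eq_zero fun w hw hfree => by
        rw [hsum w hw, hfree _ h₁, hfree _ h₂, sub_zero]
    have hexact : ∀ w : F × Fin 4 → ℤ, (∀ κ, w (G.rot κ) = w κ) → w κ₁ = w κ₂ := fun w hw => by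
      have hpair := sum_smul_glue hw fun s => n s.1
      simp only [hn, smul_add, Finset.sum_add_distrib, hsum w hw, add_eq_left] at hpair
      exact sub_eq_zero.1 hpair
    classical
    have hindicator := hexact (fun κ => if G.rot.SameCycle κ₁ κ then 1 else 0) fun κ =>
      if_congr Equiv.Perm.sameCycle_apply_right rfl rfl
    rw [if_pos (.refl _ _), if_neg hne] at hindicator
    exact one_ne_zero hindicator
  · have hconst := eq_of_rot_of_succ (G := G) (w := χ ∘ ν) (fun κ => congrArg χ (hν κ))
      (fun s => by
        rw [Function.comp_apply, ← hν, ← glue_eq_rot_succ]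
        exact hχ s trivial) κ₁ κ₂
    simp [hχ₁, hχ₂] at hconst

end IsQuadriculatedDisk

end SquareGluing

namespace SquareGluing

variable {F : Type*} {G : SquareGluing F}

namespace Bicoloring

theorem color_glue (C : G.Bicoloring) {s : F × Fin 4} (hs : G.glue s ≠ s) :
    C.color (G.glue s).1 = !C.color s.1 :=
  Bool.eq_not.2 (C.opposite s.1 (G.glue s).1 ⟨s.2, (G.glue s).2, rfl, hs.symm⟩).symm

variable {A : Type*} [AddCommGroup A] (C : G.Bicoloring)

/-- The value of `g` at the white square that has the side `s`, on either side of it; zero if there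
is none, that is, if `s` is a free side of a black square. -/
def sideValue (g : C.White → A) (s : F × Fin 4) : A :=
  if h : C.color s.1 = false then g ⟨s.1, h⟩
  else if h : C.color (G.glue s).1 = false then g ⟨(G.glue s).1, h⟩
  else 0

/-- The discrete wave equation with zero boundary values: the values of `g` across the two pairs of
opposite sides of a black square have the same sum. At a white square the equation is trivial. -/
def IsWave (g : C.White → A) : Prop :=
  ∀ f, C.sideValue g (f, 0) + C.sideValue g (f, 2) = C.sideValue g (f, 1) + C.sideValue g (f, 3)

/-- The difference of the values of `g` at the two sides that meet at the corner `κ`. -/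
def cornerFlow (g : C.White → A) (κ : F × Fin 4) : A :=
  C.sideValue g κ - C.sideValue g (κ.1, κ.2 - 1)

/-- The black corners at which a free side ends. -/
def stops : Set (F × Fin 4) := {κ | C.color κ.1 = true ∧ G.FreeCorner κ}

/-- A flow along the diagonals of the black squares: `x κ` enters the diagonal at the corner `κ`.
It is conserved at the nodes, the groups of corners about a vertex between two consecutive stops;
this is expressed by pairing with all functions `χ` on the nodes. -/
structure IsDiagonalFlow [Fintype F] (x : F × Fin 4 → A) : Prop where
  eq_zero_of_white : ∀ κ : F × Fin 4, C.color κ.1 = false → x κ = 0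
  opposite : ∀ κ : F × Fin 4, x (κ.1, κ.2 + 2) = -x κ
  sum_smul : ∀ χ : F × Fin 4 → ℤ, (∀ κ ∉ C.stops, χ (G.rot κ) = χ κ) → ∑ κ, χ κ • x κ = 0

variable {C} {g : C.White → A}

theorem sideValue_of_white {s : F × Fin 4} (hs : C.color s.1 = false) :
    C.sideValue g s = g ⟨s.1, hs⟩ := dif_pos hs

theorem sideValue_of_free {s : F × Fin 4} (hs : C.color s.1 = true) (hfree : G.glue s = s) :
    C.sideValue g s = 0 := by
  simp [sideValue, hs, hfree]

theorem sideValue_glue (s : F × Fin 4) : C.sideValue g (G.glue s) = C.sideValue g s := by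
  by_cases hfree : G.glue s = s
  · rw [hfree]
  have hcol := C.color_glue hfree
  cases hs : C.color s.1 <;> simp [sideValue, hcol, hs, G.glue_involutive s]

theorem sideValue_pred (κ : F × Fin 4) :
    C.sideValue g (κ.1, κ.2 - 1) = C.sideValue g (G.rot κ) := by
  rw [rot_apply, sideValue_glue]

theorem cornerFlow_of_white {κ : F × Fin 4} (hκ : C.color κ.1 = false) :
    C.cornerFlow g κ = 0 :=
  sub_eq_zero.2 <| (sideValue_of_white hκ).trans
    (sideValue_of_white (s := (κ.1, κ.2 - 1)) hκ).symm

theorem isWave_iff_cornerFlow_opposite :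
    C.IsWave g ↔ ∀ κ : F × Fin 4, C.cornerFlow g (κ.1, κ.2 + 2) = -C.cornerFlow g κ := by
  rw [IsWave, Prod.forall]
  refine forall_congr' fun f => ⟨fun hf i => ?_, fun hf => ?_⟩
  · fin_cases i <;> grind [cornerFlow]
  · grind [cornerFlow]

theorem sum_smul_cornerFlow [Fintype F] {χ : F × Fin 4 → ℤ}
    (hχ : ∀ κ ∉ C.stops, χ (G.rot κ) = χ κ) : ∑ κ, χ κ • C.cornerFlow g κ = 0 := by
  simp only [cornerFlow, sideValue_pred, sum_smul_sub_perm]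
  refine Finset.sum_eq_zero fun κ _ => ?_
  by_cases hκ : κ ∈ C.stops
  · rw [← sideValue_pred, sideValue_of_free (s := (κ.1, κ.2 - 1)) hκ.1 hκ.2, smul_zero]
  · rw [hχ κ hκ, sub_self, zero_smul]

theorem isDiagonalFlow_cornerFlow_iff [Fintype F] :
    C.IsDiagonalFlow (C.cornerFlow g) ↔ C.IsWave g :=
  ⟨fun h => isWave_iff_cornerFlow_opposite.2 h.opposite, fun h =>
    ⟨fun _ => cornerFlow_of_white, isWave_iff_cornerFlow_opposite.1 h,
      fun _ => sum_smul_cornerFlow⟩⟩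

theorem IsDiagonalFlow.sum_eq_zero [Fintype F] {x : F × Fin 4 → A} (hx : C.IsDiagonalFlow x)
    (f : F) : ∑ i, x (f, i) = 0 := by
  have h₂ : x (f, 2) = -x (f, 0) := hx.opposite (f, 0)
  have h₃ : x (f, 3) = -x (f, 1) := hx.opposite (f, 1)
  rw [Fin.sum_univ_four, h₂, h₃]
  abel

theorem IsDiagonalFlow.exists_int [Fintype F] {x : F × Fin 4 → A} (hx : C.IsDiagonalFlow x)
    (hne : x ≠ 0) : ∃ y : F × Fin 4 → ℤ, C.IsDiagonalFlow y ∧ y ≠ 0 := by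
  obtain ⟨κ₀, hκ₀⟩ := Function.ne_iff.1 hne
  have hι : Function.Involutive fun κ : F × Fin 4 => (κ.1, κ.2 + 2) := fun κ => by
    have hmod : ∀ i : Fin 4, i + 2 + 2 = i := by decide
    simp only [hmod]
  have hfix : ∀ κ : F × Fin 4, (κ.1, κ.2 + 2) ≠ κ := fun κ h => by
    have hmod : ∀ i : Fin 4, i + 2 ≠ i := by decide
    exact hmod _ (congrArg Prod.snd h)
  obtain ⟨y, hopp, hsum, hzero, hy₀⟩ := exists_int_flow (ν := Quot.mk (StepOff G.rot C.stops))
    hι hfix hx.opposite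
    (fun χ => hx.sum_smul _ fun κ hκ => congrArg χ (Quot.sound ⟨hκ, rfl⟩).symm) hκ₀
  refine ⟨y, ⟨fun κ hκ => hzero κ (hx.eq_zero_of_white κ hκ), hopp, fun χ hχ => ?_⟩,
    Function.ne_iff.2 ⟨κ₀, hy₀⟩⟩
  exact hsum (Quot.lift χ (by rintro κ _ ⟨hκ, rfl⟩; exact (hχ κ hκ).symm))

end Bicoloring

theorem exists_sub_pred_eq {A : Type*} [AddCommGroup A] {x : Fin 4 → A} (hx : ∑ i, x i = 0) :
    ∃ p : Fin 4 → A, ∀ i, p i - p (i - 1) = x i := by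
  rw [Fin.sum_univ_four] at hx
  refine ⟨![0, x 1, x 1 + x 2, x 1 + x 2 + x 3], fun i => ?_⟩
  have h₀ : 0 - (x 1 + x 2 + x 3) = x 0 := by
    rw [zero_sub, neg_eq_iff_add_eq_zero, ← hx]
    abel
  fin_cases i
  · exact h₀
  · exact sub_zero _
  · exact add_sub_cancel_left _ _
  · exact add_sub_cancel_left _ _

namespace IsQuadriculatedDisk

variable {C : G.Bicoloring} {A : Type*} [AddCommGroup A] (hG : G.IsQuadriculatedDisk)

include hG

theorem exists_side_potential [Fintype F] {x : F × Fin 4 → A} (hsquare : ∀ f, ∑ i, x (f, i) = 0)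
    (hvertex : ∀ w : F × Fin 4 → ℤ, (∀ κ, w (G.rot κ) = w κ) → (∀ κ, G.FreeCorner κ → w κ = 0) →
      ∑ κ, w κ • x κ = 0) :
    ∃ h : F × Fin 4 → A, (∀ s, h (G.glue s) = h s) ∧ ∀ κ, h κ - h (κ.1, κ.2 - 1) = x κ := by
  choose p hp using fun f => exists_sub_pred_eq (hsquare f)
  let q : F × Fin 4 → A := fun s => p s.1 s.2
  let c : G.SideCochain A :=
    { val := fun s => q s - q (G.glue s)
      val_glue := fun s => by rw [G.glue_involutive s, neg_sub]
      val_free := fun s hs => by rw [hs, sub_self] }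
  have hc : c.IsClosed := SideCochain.isClosed_of_sum_smul_eq_zero fun w hw hfree => by
    simp only [c, smul_sub, Finset.sum_sub_distrib]
    rw [sum_smul_glue hw, ← Finset.sum_sub_distrib, ← hvertex w hw hfree]
    simp only [← smul_sub, q, hp]
  obtain ⟨n, hn⟩ := hG.exists_potential hc
  refine ⟨fun s => n s.1 + q s, fun s => ?_, fun κ => ?_⟩
  · simp only [hn, c]
    abel
  · rw [add_sub_add_left_eq_sub]
    exact hp κ.1 κ.2

theorem exists_cornerFlow_eq [Fintype F] {x : F × Fin 4 → ℤ} (hx : C.IsDiagonalFlow x) :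
    ∃ g, C.cornerFlow g = x := by
  obtain ⟨h, hglue, hpred⟩ := hG.exists_side_potential hx.sum_eq_zero
    fun w hw _ => hx.sum_smul w fun κ _ => hw κ
  have hrot : ∀ κ, h κ - h (G.rot κ) = x κ := fun κ => by rw [rot_apply, hglue, hpred]
  have hwhite : ∀ s : F × Fin 4, C.color s.1 = false → h s = h (s.1, 0) := by
    rintro ⟨f, i⟩ hf
    have hstep : ∀ j, h (f, j) = h (f, j - 1) := fun j =>
      sub_eq_zero.1 ((hpred (f, j)).trans (hx.eq_zero_of_white _ hf))
    fin_cases i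
    · rfl
    · exact hstep 1
    · exact (hstep 2).trans (hstep 1)
    · exact (hstep 3).trans ((hstep 2).trans (hstep 1))
  obtain ⟨k, hk⟩ : ∃ k, ∀ κ ∈ C.stops, h (G.rot κ) = k := by
    rcases C.stops.eq_empty_or_nonempty with hS | ⟨κ₀, hκ₀⟩
    · exact ⟨0, by simp [hS]⟩
    refine ⟨h (G.rot κ₀), fun κ hκ => apply_eq_of_sameCycle_of_sum_smul_sub_eq_zero
      (fun χ hχ => ?_) hκ hκ₀ (hG.sameCycle_rot hκ.2 hκ₀.2)⟩
    simp only [hrot]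
    exact hx.sum_smul χ hχ
  have hvalue : ∀ s, C.sideValue (fun f => h (f, 0) - k) s = h s - k := by
    have hvalue_white : ∀ s : F × Fin 4, C.color s.1 = false →
        C.sideValue (fun f => h (f, 0) - k) s = h s - k := fun s hs => by
      rw [C.sideValue_of_white hs, hwhite s hs]
    intro s
    cases hs : C.color s.1
    · exact hvalue_white s hs
    by_cases hfree : G.glue s = s
    · rw [C.sideValue_of_free hs hfree, ← hk (s.1, s.2 + 1) ⟨hs, G.freeCorner_succ_iff.2 hfree⟩,
        ← glue_eq_rot_succ, hglue, sub_self]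
    · rw [← C.sideValue_glue, hvalue_white _ (by rw [C.color_glue hfree, hs]; rfl), hglue]
  refine ⟨fun f => h (f, 0) - k, funext fun κ => ?_⟩
  rw [Bicoloring.cornerFlow, hvalue, hvalue, sub_sub_sub_cancel_right, hpred]

/-- A nonzero wave with zero flow is constant, and then no side of a black square is free. -/
theorem isWave_one_of_cornerFlow_eq_zero [Finite F] {g : C.White → A} (hg : g ≠ 0)
    (hflow : C.cornerFlow g = 0) : C.IsWave (1 : C.White → ℤ) := by
  have := hG.simplyConnectedSpace
  obtain ⟨f₀, hf₀⟩ := Function.ne_iff.1 hg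
  have hsucc : ∀ s : F × Fin 4, C.sideValue g (s.1, s.2 + 1) = C.sideValue g s := fun s => by
    simpa [Bicoloring.cornerFlow, sub_eq_zero] using congrFun hflow (s.1, s.2 + 1)
  have hrot : ∀ κ, C.sideValue g (G.rot κ) = C.sideValue g κ := fun κ => by
    rw [← C.sideValue_pred]
    exact (sub_eq_zero.1 (congrFun hflow κ)).symm
  have hvalue : ∀ s, C.sideValue (1 : C.White → ℤ) s = 1 := by
    intro s
    cases hs : C.color s.1
    · exact C.sideValue_of_white hs
    have hfree : G.glue s ≠ s := fun hfree => hf₀ <| calc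
      g f₀ = C.sideValue g (f₀, 0) := (Bicoloring.sideValue_of_white (s := (f₀.1, 0)) f₀.2).symm
      _ = C.sideValue g s := eq_of_rot_of_succ hrot hsucc _ _
      _ = 0 := C.sideValue_of_free hs hfree
    rw [← C.sideValue_glue, C.sideValue_of_white (by rw [C.color_glue hfree, hs]; rfl)]
    rfl
  intro f
  simp only [hvalue]

theorem exists_int_isWave [Finite F] {g : C.White → A} (hg : C.IsWave g) (hne : g ≠ 0) :
    ∃ g : C.White → ℤ, C.IsWave g ∧ g ≠ 0 := by
  have := Fintype.ofFinite F
  by_cases hflow : C.cornerFlow g = 0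
  · obtain ⟨f₀, -⟩ := Function.ne_iff.1 hne
    exact ⟨1, hG.isWave_one_of_cornerFlow_eq_zero hne hflow,
      Function.ne_iff.2 ⟨f₀, one_ne_zero⟩⟩
  · obtain ⟨y, hy, hy₀⟩ := (Bicoloring.isDiagonalFlow_cornerFlow_iff.2 hg).exists_int hflow
    obtain ⟨g', rfl⟩ := hG.exists_cornerFlow_eq hy
    refine ⟨g', Bicoloring.isDiagonalFlow_cornerFlow_iff.1 hy, ?_⟩
    rintro rfl
    exact hy₀ (funext fun κ => by simp [Bicoloring.cornerFlow, Bicoloring.sideValue])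

end IsQuadriculatedDisk

end SquareGluing

theorem det_eq_zero_or_one_or_neg_one_of_lift_kernel {n : Type*} [Fintype n] [DecidableEq n]
    {M : Matrix n n ℤ}
    (hM : ∀ p : ℕ, p.Prime → ∀ v : n → ZMod p, v ≠ 0 → M.map (Int.cast : ℤ → ZMod p) *ᵥ v = 0 →
      ∃ u : n → ℤ, u ≠ 0 ∧ M *ᵥ u = 0) :
    M.det = 0 ∨ M.det = 1 ∨ M.det = -1 := by
  by_cases hunit : M.det.natAbs = 1
  · exact .inr (Int.natAbs_eq_iff.1 hunit)
  obtain ⟨p, hp, hdvd⟩ := Nat.exists_prime_and_dvd hunit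
  have : Fact p.Prime := ⟨hp⟩
  have hdet : (M.map (Int.cast : ℤ → ZMod p)).det = 0 := by
    rw [← Int.cast_det]
    exact (ZMod.intCast_zmod_eq_zero_iff_dvd _ p).2 (Int.natCast_dvd.2 hdvd)
  obtain ⟨v, hv, hMv⟩ := Matrix.exists_mulVec_eq_zero_iff.2 hdet
  exact .inl (Matrix.exists_mulVec_eq_zero_iff.1 (hM p hp v hv hMv))

namespace SquareGluing

variable {F : Type*} {G : SquareGluing F} {C : G.Bicoloring}

namespace Bicoloring

theorem glue_ne_of_fst_glue_eq {x : C.Black} {y : C.White} {k : Fin 4}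
    (h : (G.glue (x, k)).1 = y) : G.glue (x, k) ≠ (x.1, k) := fun hfree => by
  have hxy : (x : F) = y := by rw [← h, hfree]
  exact Bool.false_ne_true (y.2.symm.trans (hxy ▸ x.2))

theorem shareSide_iff (x : C.Black) (y : C.White) :
    G.ShareSide x y ↔ ∃ k, (G.glue (x, k)).1 = y := by
  constructor
  · rintro ⟨k, l, hkl, -⟩
    exact ⟨k, congrArg Prod.fst hkl⟩
  · rintro ⟨k, hk⟩
    have hglue : G.glue (x, k) = (y.1, (G.glue (x, k)).2) := Prod.ext hk rfl
    exact ⟨k, _, hglue, fun h => glue_ne_of_fst_glue_eq hk (hglue.trans h.symm)⟩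

variable {A : Type*} [AddCommGroup A] {g : C.White → A}

theorem sideValue_eq_of_fst_glue_eq {x : C.Black} {y : C.White} {k : Fin 4}
    (h : (G.glue (x, k)).1 = y) : C.sideValue g (x, k) = g y := by
  have hy : C.color (G.glue (x, k)).1 = false := h ▸ y.2
  rw [← sideValue_glue, sideValue_of_white hy]
  exact congrArg g (Subtype.ext h)

theorem sideValue_of_forall_fst_glue_ne {x : C.Black} {k : Fin 4}
    (h : ∀ y : C.White, (G.glue (x, k)).1 ≠ y) : C.sideValue g (x, k) = 0 := by
  refine sideValue_of_free x.2 (of_not_not fun hfree => ?_)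
  exact h ⟨_, by rw [C.color_glue hfree, x.2]; rfl⟩ rfl

open Classical in
theorem sideValue_eq_sum [Fintype C.White] (x : C.Black) (k : Fin 4) :
    C.sideValue g (x, k) = ∑ y : C.White, if (G.glue (x, k)).1 = y then g y else 0 := by
  by_cases h : ∃ y : C.White, (G.glue (x, k)).1 = y
  · obtain ⟨y, hy⟩ := h
    simp only [sideValue_eq_of_fst_glue_eq hy, hy, Subtype.coe_inj, Fintype.sum_ite_eq]
  · push Not at h
    simp only [sideValue_of_forall_fst_glue_ne h, h, if_false, Finset.sum_const_zero]

theorem sideValue_units_smul {σ τ : F → ℤˣ}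
    (hσ : ∀ s, G.glue s ≠ s → σ (G.glue s).1 = τ s.1 * (-1) ^ (s.2 : ℕ)) (x : C.Black)
    (k : Fin 4) :
    C.sideValue (fun y => σ y • g y) (x, k) = τ x • (-1 : ℤˣ) ^ (k : ℕ) • C.sideValue g (x, k) := by
  by_cases h : ∃ y : C.White, (G.glue (x, k)).1 = y
  · obtain ⟨y, hy⟩ := h
    rw [sideValue_eq_of_fst_glue_eq hy, sideValue_eq_of_fst_glue_eq hy, ← hy,
      hσ _ (glue_ne_of_fst_glue_eq hy), mul_smul]
  · push Not at h
    rw [sideValue_of_forall_fst_glue_ne h, sideValue_of_forall_fst_glue_ne h, smul_zero, smul_zero]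

theorem isWave_units_smul_iff {σ τ : F → ℤˣ}
    (hσ : ∀ s, G.glue s ≠ s → σ (G.glue s).1 = τ s.1 * (-1) ^ (s.2 : ℕ)) :
    C.IsWave (fun y => σ y • g y) ↔ ∀ x : C.Black, ∑ k, C.sideValue g (x, k) = 0 := by
  have hsign : ∀ (ε : ℤˣ) (p q r s : A), ε • (-1 : ℤˣ) ^ 0 • p + ε • (-1 : ℤˣ) ^ 2 • r =
      ε • (-1 : ℤˣ) ^ 1 • q + ε • (-1 : ℤˣ) ^ 3 • s ↔ p + q + r + s = 0 := by
    intro ε p q r s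
    have heven : (-1 : ℤˣ) ^ 2 = 1 := rfl
    have hodd : (-1 : ℤˣ) ^ 3 = -1 := rfl
    rw [← smul_add, ← smul_add, smul_left_cancel_iff, pow_zero, pow_one, heven, hodd, one_smul,
      one_smul, Units.neg_smul, Units.neg_smul, one_smul, one_smul]
    grind
  have hblack : ∀ x : C.Black,
      C.sideValue (fun y => σ y • g y) (x, 0) + C.sideValue (fun y => σ y • g y) (x, 2) =
        C.sideValue (fun y => σ y • g y) (x, 1) + C.sideValue (fun y => σ y • g y) (x, 3) ↔
      ∑ k, C.sideValue g (x, k) = 0 := fun x => by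
    rw [Fin.sum_univ_four]
    simp only [sideValue_units_smul hσ]
    exact hsign _ _ _ _ _
  refine ⟨fun h x => (hblack x).1 (h x), fun h f => ?_⟩
  cases hf : C.color f
  · have hvalue : ∀ i, C.sideValue (fun y => σ y • g y) (f, i) = σ f • g ⟨f, hf⟩ := fun _ =>
      sideValue_of_white hf
    simp only [hvalue]
  · exact (hblack ⟨f, hf⟩).2 (h ⟨f, hf⟩)

end Bicoloring

namespace IsQuadriculatedDisk

variable [Finite F] (hG : G.IsQuadriculatedDisk)

include hG

open Classical in
theorem sum_sideValue_black [Fintype C.White] {A : Type*} [AddCommGroup A] (g : C.White → A)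
    (x : C.Black) :
    ∑ k, C.sideValue g (x, k) = ∑ y : C.White, if G.ShareSide x y then g y else 0 := by
  simp only [Bicoloring.sideValue_eq_sum]
  rw [Finset.sum_comm]
  refine Finset.sum_congr rfl fun y _ => ?_
  by_cases h : G.ShareSide x y
  · obtain ⟨k, hk⟩ := (Bicoloring.shareSide_iff x y).1 h
    have hunique : ∀ k', (G.glue (x, k')).1 = y ↔ k = k' := fun k' =>
      ⟨fun hk' => hG.side_unique (Bicoloring.glue_ne_of_fst_glue_eq hk)
        (Bicoloring.glue_ne_of_fst_glue_eq hk') (hk.trans hk'.symm), fun h => h ▸ hk⟩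
    simp only [h, hunique, Fintype.sum_ite_eq, if_true]
  · have hne : ∀ k, (G.glue (x, k)).1 ≠ y := fun k hk =>
      h ((Bicoloring.shareSide_iff x y).2 ⟨k, hk⟩)
    simp only [h, hne, if_false, Finset.sum_const_zero]

theorem blackToWhite_mulVec {R : Type*} [CommRing R] {b w : ℕ} (eb : C.Black ≃ Fin b)
    (ew : C.White ≃ Fin w) (v : Fin w → R) (i : Fin b) :
    ((C.blackToWhite eb ew).map (Int.cast : ℤ → R) *ᵥ v) i =
      ∑ k, C.sideValue (v ∘ ew) (eb.symm i, k) := by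
  classical
  have := Fintype.ofFinite C.White
  rw [hG.sum_sideValue_black, Matrix.mulVec, dotProduct, ← ew.sum_comp]
  refine Finset.sum_congr rfl fun y _ => ?_
  simp [Bicoloring.blackToWhite]

theorem mulVec_eq_zero_iff_isWave {R : Type*} [CommRing R] {σ τ : F → ℤˣ}
    (hσ : ∀ s, G.glue s ≠ s → σ (G.glue s).1 = τ s.1 * (-1) ^ (s.2 : ℕ)) {b w : ℕ}
    (eb : C.Black ≃ Fin b) (ew : C.White ≃ Fin w) (v : Fin w → R) :
    (C.blackToWhite eb ew).map (Int.cast : ℤ → R) *ᵥ v = 0 ↔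
      C.IsWave fun y => σ y • v (ew y) := by
  rw [funext_iff, ← eb.forall_congr_right]
  simp only [hG.blackToWhite_mulVec, Equiv.symm_apply_apply]
  exact (Bicoloring.isWave_units_smul_iff hσ).symm

theorem det_blackToWhite {n : ℕ} (eb : C.Black ≃ Fin n) (ew : C.White ≃ Fin n) :
    (C.blackToWhite eb ew).det = 0 ∨ (C.blackToWhite eb ew).det = 1 ∨
      (C.blackToWhite eb ew).det = -1 := by
  obtain ⟨σ, τ, hσ⟩ := hG.exists_sign
  refine det_eq_zero_or_one_or_neg_one_of_lift_kernel fun p _ v hv hMv => ?_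
  have hwave := (hG.mulVec_eq_zero_iff_isWave hσ eb ew v).1 hMv
  obtain ⟨j, hj⟩ := Function.ne_iff.1 hv
  have hne : (fun y : C.White => σ y • v (ew y)) ≠ 0 := Function.ne_iff.2
    ⟨ew.symm j, by simpa [smul_eq_zero_iff_eq] using hj⟩
  obtain ⟨g, hg, hg₀⟩ := hG.exists_int_isWave hwave hne
  obtain ⟨y, hy⟩ := Function.ne_iff.1 hg₀
  let u : Fin n → ℤ := fun j => σ (ew.symm j) • g (ew.symm j)
  have hu : u ≠ 0 := Function.ne_iff.2 ⟨ew y, by simpa [u, smul_eq_zero_iff_eq] using hy⟩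
  have hker := (hG.mulVec_eq_zero_iff_isWave hσ eb ew u).2 <| by
    simpa only [u, Equiv.symm_apply_apply, smul_smul, Int.units_mul_self, one_smul] using hg
  refine ⟨u, hu, ?_⟩
  exact (congrArg (· *ᵥ _) (Matrix.map_id' _)).symm.trans hker

end IsQuadriculatedDisk

namespace Bicoloring

variable {n : ℕ} (eb : C.Black ≃ Fin n) (ew : C.White ≃ Fin n)

theorem tilingSign_eq [Fintype F] (T₀ T : C.DominoTiling) :
    C.tilingSign T₀ T = Equiv.Perm.sign (eb.equivCongr ew T₀.1) *
      Equiv.Perm.sign (eb.equivCongr ew T.1) := by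
  classical
  have hconj : (eb.equivCongr ew T₀.1)⁻¹ * eb.equivCongr ew T.1 =
      (eb.symm.trans (T.1.trans T₀.1.symm)).trans eb := by
    rw [inv_mul_eq_iff_eq_mul]
    ext x
    simp
  rw [← Equiv.Perm.sign_inv (eb.equivCongr ew T₀.1), ← Equiv.Perm.sign_mul, hconj,
    Equiv.Perm.sign_symm_trans_trans]
  unfold tilingSign
  congr!

theorem det_blackToWhite_eq_sum [Fintype C.DominoTiling] :
    (C.blackToWhite eb ew).det =
      ∑ T : C.DominoTiling, (Equiv.Perm.sign (eb.equivCongr ew T.1) : ℤ) := by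
  classical
  have := Fintype.ofEquiv _ eb.symm
  have := Fintype.ofEquiv _ ew.symm
  have hprod : ∀ T : C.Black ≃ C.White,
      ∏ i, C.blackToWhite eb ew i (eb.equivCongr ew T i) =
        if ∀ x : C.Black, G.ShareSide x (T x) then 1 else 0 := fun T => by
    rw [← eb.prod_comp]
    simp [blackToWhite, Fintype.prod_boole]
  calc
    (C.blackToWhite eb ew).det
      = ∑ T : C.Black ≃ C.White, (Equiv.Perm.sign (eb.equivCongr ew T) : ℤ) *
          if ∀ x : C.Black, G.ShareSide x (T x) then 1 else 0 := by
        rw [← Matrix.det_transpose, Matrix.det_apply', ← (eb.equivCongr ew).sum_comp]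
        simp only [Matrix.transpose_apply, hprod]
        congr!
    _ = ∑ T : C.DominoTiling, (Equiv.Perm.sign (eb.equivCongr ew T.1) : ℤ) := by
        simp only [mul_ite, mul_one, mul_zero, ← Finset.sum_filter]
        exact Finset.sum_subtype _ (by simp) _

theorem signedTilingCount_eq [Fintype F] (T₀ : C.DominoTiling) :
    C.signedTilingCount T₀ = (C.blackToWhite eb ew).det ∨
      C.signedTilingCount T₀ = -(C.blackToWhite eb ew).det := by
  have hcount : C.signedTilingCount T₀ =
      (Equiv.Perm.sign (eb.equivCongr ew T₀.1) : ℤ) * (C.blackToWhite eb ew).det := by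
    simp only [signedTilingCount, tilingSign_eq eb ew, Units.val_mul, det_blackToWhite_eq_sum,
      Finset.mul_sum]
  rcases Int.units_eq_one_or (Equiv.Perm.sign (eb.equivCongr ew T₀.1)) with h | h
  · left
    rw [hcount, h, Units.val_one, one_mul]
  · right
    rw [hcount, h, Units.val_neg, Units.val_one, neg_one_mul]

end Bicoloring

end SquareGluing

theorem corollary2 {F : Type*} [Fintype F] (G : SquareGluing F) (hG : G.IsQuadriculatedDisk)
    (C : G.Bicoloring) (n : ℕ) (eb : C.Black ≃ Fin n) (ew : C.White ≃ Fin n) :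
    ((C.blackToWhite eb ew).det = 0 ∨ (C.blackToWhite eb ew).det = 1 ∨
      (C.blackToWhite eb ew).det = -1) ∧
    ∀ T₀ : C.DominoTiling,
      (C.signedTilingCount T₀ = (C.blackToWhite eb ew).det ∨
        C.signedTilingCount T₀ = -(C.blackToWhite eb ew).det) ∧
      (C.signedTilingCount T₀ = 0 ∨ C.signedTilingCount T₀ = 1 ∨
        C.signedTilingCount T₀ = -1) := by
  have hdet := hG.det_blackToWhite eb ew
  refine ⟨hdet, fun T₀ => ?_⟩
  have hcount := C.signedTilingCount_eq eb ew T₀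
  refine ⟨hcount, ?_⟩
  omega
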